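/- For $x\in[0,1)$ let $T x = \frac1x-\lfloor \frac1x\rfloor$ if $x\neq 0$ and $T0=0$, and let $a_k(x)=\lfloor 1/T^{k-1}x\rfloor$ ($k\ge 1$, $T^{k-1}x\ne 0$) be the partial quotients of the regular continued fraction expansion $x=[a_1(x),a_2(x),\dots]$. For $n\ge 1$ let $$\frac{p_n(x)}{q_n(x)}=[a_1(x),\dots,a_n(x)]=\cfrac{1}{a_1(x)+\cfrac{1}{\ddots+\cfrac{1}{a_n(x)}}}$$ be the $n$-th convergent of $x$, written in lowest terms with $q_n(x)\ge 1$ (if $x$ is rational and its expansion ends before step $n$, the $n$-th convergent is $x$ itself). Let $\mathcal L$ denote Lebesgue measure on $[0,1)$. Then for every $\delta>0$ there exist an integer $N>0$ and real numbers $B>0$ and $\alpha>0$ such that for all $n\ge N$, $$\mathcal L\left(\left\{x\in[0,1):\ \left|\frac1n\log q_n(x)-\frac{\pi^2}{12\log 2}\right|\ge\delta\right\}\right)\le B\,e^{-\alpha n}.$$ -/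

import Mathlib

/-- `cfDenom n x` is the denominator `q_n(x)`, in lowest terms, of the `n`-th convergent
`[a₁(x), …, a_n(x)]` of the regular continued fraction expansion of `x ∈ [0, 1)`. If `x` is
rational and its expansion has length less than `n`, then the `n`-th convergent is `x` itself. -/
noncomputable def cfDenom (n : ℕ) (x : ℝ) : ℕ :=
  (x.convergent n).den

/-!
Let `T` be the Gauss map and `λ = π² / (12 log 2)`. Since
`q_{n+1}(x) = q_n(T x) / r_{n+1}(x)`, where `r_n` denotes the `n`-th convergent, `log q_n` is the sum
of `-log r_{n-k}(T^k x)` over `k < n`. The relative error of a convergent halves at each step, so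
`log q_n` differs from the Birkhoff sum `S_n` of `-log` by at most `2 log 2` at irrational points
(`abs_log_cfDenom_sub_logSum_le`). It remains to prove exponential large deviations for `S_n`.

Let `P` be the transfer operator of `T`, normalised by the Gauss density `1 / (1 + x)` so that
`P 1 = 1`. Summation by parts in the digit shows that `P` contracts Lipschitz constants on `[0, 1]`
by the factor `7 / 8` (`LipUnit.gaussOp`), and `P (-log)` is Lipschitz although `-log` is unbounded.
As `P` preserves the Gauss mean, and the Gauss mean of `-log` is `λ`, the functions `P^k (-log)`
converge to `λ` uniformly and exponentially (`abs_gaussIter_sub_levyConst_le`).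

Hence `u = ∑_{1 ≤ k ≤ N} (P^k (-log) - λ)` solves the Poisson equation `P (-log + u) = λ + u` up to
any prescribed error. Expanding to first order in `t`, the function `1 + t u` satisfies
`P (exp (-t log) (1 + t u)) ≤ exp (t λ + |t| ε) (1 + t u)` for all small `t` of either sign
(`exists_tilted_supersolution`). This step replaces perturbation theory for the leading eigenvalue
of the tilted operator. Iterating, the integral of `exp (t S_n)` is at most a constant times
`exp (n (t λ + |t| ε))`, and Markov's inequality for `t = ± t₀` gives the deviation bound
(`exists_volume_logSum_deviation_le`).
-/

open MeasureTheory Filter Topology Set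

/-! ### The normalised transfer operator -/

/-- The probability `(1 + x) / ((a + x) (a + 1 + x))`, with `a = k + 1`, of jumping from `x` to the
`a`-th preimage `1 / (a + x)` under the Gauss map, for the chain dual to the Gauss map with respect
to the Gauss measure. Digits `a ≥ 1` are indexed by `k = a - 1`. -/
noncomputable def gaussWeight (k : ℕ) (x : ℝ) : ℝ := (1 + x) / ((k + 1 + x) * (k + 2 + x))

/-- The transfer operator of the Gauss map, normalised by the Gauss density `1 / (1 + x)`, so that
it fixes constants. -/
noncomputable def gaussOp (g : ℝ → ℝ) (x : ℝ) : ℝ :=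
  ∑' k : ℕ, gaussWeight k x * g ((k + 1 + x)⁻¹)

theorem gaussWeight_nonneg (k : ℕ) {x : ℝ} (hx : 0 ≤ x) : 0 ≤ gaussWeight k x := by
  unfold gaussWeight; positivity

theorem gaussWeight_eq_sub (k : ℕ) {x : ℝ} (hx : 0 ≤ x) :
    gaussWeight k x = (1 + x) / (k + 1 + x) - (1 + x) / ((k + 1 : ℕ) + 1 + x) := by
  unfold gaussWeight
  push_cast
  have h1 : (k : ℝ) + 1 + x ≠ 0 := by positivity
  have h2 : (k : ℝ) + 2 + x ≠ 0 := by positivity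
  have h3 : (k : ℝ) + 1 + 1 + x ≠ 0 := by positivity
  field_simp
  ring

theorem hasSum_gaussWeight {x : ℝ} (hx : 0 ≤ x) : HasSum (fun k => gaussWeight k x) 1 := by
  rw [hasSum_iff_tendsto_nat_of_nonneg (fun k => gaussWeight_nonneg k hx)]
  have h (n : ℕ) : ∑ k ∈ Finset.range n, gaussWeight k x = 1 - (1 + x) / (n + 1 + x) := by
    simp_rw [gaussWeight_eq_sub _ hx]
    rw [Finset.sum_range_sub' (fun k : ℕ => (1 + x) / ((k : ℝ) + 1 + x))]
    have : (1 + x) ≠ 0 := by positivity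
    simp [this]
  simp_rw [h]
  have : Tendsto (fun n : ℕ => (1 + x) / ((n : ℝ) + 1 + x)) atTop (𝓝 0) := by
    apply Tendsto.div_atTop tendsto_const_nhds
    simp_rw [add_assoc]
    exact tendsto_atTop_add_const_right _ _ tendsto_natCast_atTop_atTop
  simpa using tendsto_const_nhds.sub this

/-- Uniform in `x`, summable in `k`, so functions growing like a square root of the digit have
bounded image under the transfer operator. -/
theorem gaussWeight_mul_sqrt_le (k : ℕ) {x : ℝ} (hx : x ∈ Icc (0 : ℝ) 1) :
    gaussWeight k x * √(k + 1) ≤ 2 * ((k : ℝ) + 1) ^ (-(3 / 2) : ℝ) := by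
  have hk : (0 : ℝ) < k + 1 := by positivity
  have e : ((k : ℝ) + 1) ^ (-(3 / 2) : ℝ) = √(k + 1) / (k + 1) ^ 2 := by
    rw [Real.sqrt_eq_rpow, ← Real.rpow_natCast, ← Real.rpow_sub hk]; norm_num
  rw [e, mul_div_assoc', mul_comm, mul_comm (2 : ℝ), mul_div_assoc]
  refine mul_le_mul_of_nonneg_left ?_ (Real.sqrt_nonneg _)
  unfold gaussWeight
  obtain ⟨h0, h1⟩ := hx
  gcongr
  · linarith
  · rw [sq]; exact mul_le_mul (by linarith) (by linarith) (by positivity) (by positivity)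

theorem summable_two_mul_rpow : Summable fun k : ℕ => 2 * ((k : ℝ) + 1) ^ (-(3 / 2) : ℝ) := by
  have := (summable_nat_add_iff 1).2 (Real.summable_nat_rpow.2 (by norm_num : (-(3 / 2) : ℝ) < -1))
  simpa using this.mul_left 2

theorem summable_gaussWeight_mul {x A : ℝ} (hx : x ∈ Icc (0 : ℝ) 1) {G : ℕ → ℝ}
    (hG : ∀ k : ℕ, |G k| ≤ A * √(k + 1)) : Summable fun k => gaussWeight k x * G k := by
  refine Summable.of_norm_bounded (summable_two_mul_rpow.mul_left A) fun k => ?_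
  rw [Real.norm_eq_abs, abs_mul, abs_of_nonneg (gaussWeight_nonneg k hx.1)]
  have hA : 0 ≤ A := by
    have := (abs_nonneg _).trans (hG 0)
    simpa using this
  calc gaussWeight k x * |G k| ≤ gaussWeight k x * (A * √(k + 1)) :=
        mul_le_mul_of_nonneg_left (hG k) (gaussWeight_nonneg k hx.1)
    _ = A * (gaussWeight k x * √(k + 1)) := by ring
    _ ≤ _ := mul_le_mul_of_nonneg_left (gaussWeight_mul_sqrt_le k hx) hA

theorem abs_le_mul_sqrt_of_abs_le {A : ℝ} {G : ℕ → ℝ} (hG : ∀ k, |G k| ≤ A) (k : ℕ) :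
    |G k| ≤ A * √(k + 1) := by
  have hA : 0 ≤ A := (abs_nonneg _).trans (hG 0)
  have : (1 : ℝ) ≤ √(k + 1) := Real.one_le_sqrt.2 (by linarith [(Nat.cast_nonneg k : (0 : ℝ) ≤ k)])
  nlinarith [hG k]

/-! ### Contraction of Lipschitz constants -/

/-- Summation by parts for a series. -/
theorem abs_tsum_sub_mul_le {D G b : ℕ → ℝ} {B : ℝ} (h0 : D 0 = 0)
    (hD : Tendsto (fun n => D (n + 1) * G n) atTop (𝓝 0))
    (hs : Summable fun k => (D k - D (k + 1)) * G k)
    (hb : ∀ k, |D (k + 1) * (G (k + 1) - G k)| ≤ b k)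
    (hB : ∀ n, ∑ k ∈ Finset.range n, b k ≤ B) :
    |∑' k, (D k - D (k + 1)) * G k| ≤ B := by
  have key (n : ℕ) : ∑ k ∈ Finset.range (n + 1), (D k - D (k + 1)) * G k =
      ∑ k ∈ Finset.range n, D (k + 1) * (G (k + 1) - G k) - D (n + 1) * G n := by
    induction n with
    | zero => simp [h0]
    | succ n ih => rw [Finset.sum_range_succ, ih, Finset.sum_range_succ _ n]; ring
  have h1 := (tendsto_add_atTop_iff_nat 1).2 hs.hasSum.tendsto_sum_nat
  have h2 := (h1.add hD).abs
  rw [add_zero] at h2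
  refine le_of_tendsto h2 (Eventually.of_forall fun n => ?_)
  rw [key, sub_add_cancel]
  exact (Finset.abs_sum_le_sum_abs _ _).trans ((Finset.sum_le_sum fun k _ => hb k).trans (hB n))

/-- The modulus of continuity of `x ↦ ∑ k, gaussWeight k x * G k x`, where `G` and `H` stand for
the values of `G k` at `x` and `y`. The variation of the weights is paid for by the increments of
`G` in `k`, the variation of `G` by the weights. -/
theorem abs_tsum_gaussWeight_sub_le {x y A C F : ℝ} (hx : x ∈ Icc (0 : ℝ) 1)
    (hy : y ∈ Icc (0 : ℝ) 1) {G H c e : ℕ → ℝ}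
    (hG : ∀ k : ℕ, |G k| ≤ A * √(k + 1)) (hH : ∀ k : ℕ, |H k| ≤ A * √(k + 1))
    (hc : ∀ k, |G (k + 1) - G k| ≤ c k)
    (hC : ∀ n, ∑ k ∈ Finset.range n, ((k : ℝ) + 1) / (k + 2) ^ 2 * c k ≤ C)
    (he : ∀ k, |G k - H k| ≤ e k * |x - y|)
    (hF : HasSum (fun k => gaussWeight k y * e k) F) :
    |∑' k, gaussWeight k x * G k - ∑' k, gaussWeight k y * H k| ≤ (C + F) * |x - y| := by
  obtain ⟨hx0, hx1⟩ := hx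
  obtain ⟨hy0, hy1⟩ := hy
  have sxG := summable_gaussWeight_mul ⟨hx0, hx1⟩ hG
  have syG := summable_gaussWeight_mul ⟨hy0, hy1⟩ hG
  have syH := summable_gaussWeight_mul ⟨hy0, hy1⟩ hH
  set D : ℕ → ℝ := fun m => (1 + x) / (m + 1 + x) - (1 + y) / (m + 1 + y) with hDdef
  have hDw (k : ℕ) : D k - D (k + 1) = gaussWeight k x - gaussWeight k y := by
    rw [gaussWeight_eq_sub k hx0, gaussWeight_eq_sub k hy0]; simp only [hDdef]; ring
  have hDle (k : ℕ) : |D (k + 1)| ≤ ((k : ℝ) + 1) / (k + 2) ^ 2 * |x - y| := by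
    have : D (k + 1) = ((k : ℝ) + 1) / ((k + 2 + x) * (k + 2 + y)) * (x - y) := by
      simp only [hDdef]
      push_cast
      have h1 : (k : ℝ) + 1 + 1 + x ≠ 0 := by positivity
      have h2 : (k : ℝ) + 1 + 1 + y ≠ 0 := by positivity
      have h3 : (k : ℝ) + 2 + x ≠ 0 := by positivity
      have h4 : (k : ℝ) + 2 + y ≠ 0 := by positivity
      field_simp
      ring
    rw [this, abs_mul, abs_of_nonneg (by positivity)]
    gcongr
    rw [sq]; exact mul_le_mul (by linarith) (by linarith) (by positivity) (by positivity)
  have hA : 0 ≤ A := by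
    have := (abs_nonneg _).trans (hG 0)
    simpa using this
  have hlim : Tendsto (fun n => D (n + 1) * G n) atTop (𝓝 0) := by
    have hb (n : ℕ) : |D (n + 1) * G n| ≤ A * |x - y| * (1 / √(n + 1)) := by
      rw [abs_mul]
      have hn : (0 : ℝ) < n + 1 := by positivity
      have hs := Real.sq_sqrt hn.le
      have hs0 := Real.sqrt_pos.2 hn
      have h1 : ((n : ℝ) + 1) / (n + 2) ^ 2 ≤ 1 / (n + 1) := by
        rw [div_le_div_iff₀ (by positivity) hn]; nlinarith
      calc |D (n + 1)| * |G n| ≤ (1 / (n + 1) * |x - y|) * (A * √(n + 1)) := by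
            gcongr
            · exact (hDle n).trans (by gcongr)
            · exact hG n
        _ = A * |x - y| * (1 / √(n + 1)) := by
            nth_rw 1 [← hs]
            field_simp
    have h0 : Tendsto (fun n : ℕ => A * |x - y| * (1 / √((n : ℝ) + 1))) atTop (𝓝 0) := by
      have : Tendsto (fun n : ℕ => 1 / √((n : ℝ) + 1)) atTop (𝓝 0) := by
        apply Tendsto.div_atTop tendsto_const_nhds
        exact Real.tendsto_sqrt_atTop.comp
          (tendsto_atTop_add_const_right _ _ tendsto_natCast_atTop_atTop)
      simpa using this.const_mul (A * |x - y|)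
    exact squeeze_zero_norm hb h0
  have first : |∑' k, (D k - D (k + 1)) * G k| ≤ C * |x - y| := by
    refine abs_tsum_sub_mul_le (b := fun k => ((k : ℝ) + 1) / (k + 2) ^ 2 * c k * |x - y|)
      ?_ hlim ?_ ?_ ?_
    · have h1 : 1 + x ≠ 0 := by positivity
      have h2 : 1 + y ≠ 0 := by positivity
      simp [hDdef, h1, h2]
    · simp_rw [hDw, sub_mul]; exact sxG.sub syG
    · intro k
      rw [abs_mul]
      calc |D (k + 1)| * |G (k + 1) - G k| ≤ (((k : ℝ) + 1) / (k + 2) ^ 2 * |x - y|) * c k := by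
            gcongr
            · exact hDle k
            · exact hc k
        _ = _ := by ring
    · intro n
      rw [← Finset.sum_mul]
      exact mul_le_mul_of_nonneg_right (hC n) (abs_nonneg _)
  have second : |∑' k, gaussWeight k y * (G k - H k)| ≤ F * |x - y| := by
    rw [← Real.norm_eq_abs]
    refine tsum_of_norm_bounded (hF.mul_right |x - y|) fun k => ?_
    rw [Real.norm_eq_abs, abs_mul, abs_of_nonneg (gaussWeight_nonneg k hy0), mul_assoc]
    exact mul_le_mul_of_nonneg_left (he k) (gaussWeight_nonneg k hy0)
  have split : ∑' k, gaussWeight k x * G k - ∑' k, gaussWeight k y * H k =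
      ∑' k, (D k - D (k + 1)) * G k + ∑' k, gaussWeight k y * (G k - H k) := by
    simp_rw [hDw, sub_mul, mul_sub]
    rw [sxG.tsum_sub syG, syG.tsum_sub syH]
    ring
  rw [split, add_mul]
  exact (abs_add_le _ _).trans (add_le_add first second)

theorem inv_natCast_add_mem_Icc (k : ℕ) {x : ℝ} (hx : 0 ≤ x) :
    ((k : ℝ) + 1 + x)⁻¹ ∈ Icc (0 : ℝ) 1 :=
  ⟨by positivity, inv_le_one_of_one_le₀ (by linarith [(Nat.cast_nonneg k : (0 : ℝ) ≤ k)])⟩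

/-- A function with Lipschitz constant `K` on the unit interval. -/
def LipUnit (K : ℝ) (g : ℝ → ℝ) : Prop :=
  ∀ x ∈ Icc (0 : ℝ) 1, ∀ y ∈ Icc (0 : ℝ) 1, |g x - g y| ≤ K * |x - y|

theorem LipUnit.abs_le {K : ℝ} {g : ℝ → ℝ} (h : LipUnit K g) {x : ℝ} (hx : x ∈ Icc (0 : ℝ) 1) :
    |g x| ≤ |g 0| + |K| := by
  have h1 := h x hx 0 ⟨le_rfl, zero_le_one⟩
  have h2 : |x - 0| ≤ 1 := by rw [sub_zero, abs_of_nonneg hx.1]; exact hx.2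
  have h3 : K * |x - 0| ≤ |K| * 1 := mul_le_mul (le_abs_self K) h2 (abs_nonneg _) (abs_nonneg _)
  have h4 := abs_sub_abs_le_abs_sub (g x) (g 0)
  linarith

/-- The spectral gap of the transfer operator: it contracts Lipschitz constants. The variation of
the weights contributes `1 / 4` and the contraction of the branches `5 / 8`; for the latter, only
the first branch needs more than the bound `1 / 4` on its slope. -/
theorem LipUnit.gaussOp {K : ℝ} {g : ℝ → ℝ} (h : LipUnit K g) :
    LipUnit (7 / 8 * K) (gaussOp g) := by
  intro x hx y hy
  have hK : 0 ≤ K := by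
    have := (abs_nonneg _).trans (h 1 ⟨zero_le_one, le_rfl⟩ 0 ⟨le_rfl, zero_le_one⟩)
    simpa using this
  have hb (z : ℝ) (hz : z ∈ Icc (0 : ℝ) 1) (k : ℕ) : |g ((k + 1 + z)⁻¹)| ≤ |g 0| + |K| :=
    h.abs_le (inv_natCast_add_mem_Icc k hz.1)
  have hx0 := hx.1
  have hy0 := hy.1
  have hdiff (a b : ℝ) (ha : 0 < a) (hb : 0 < b) : |a⁻¹ - b⁻¹| = |a - b| / (a * b) := by
    rw [inv_sub_inv ha.ne' hb.ne', abs_div, abs_sub_comm, abs_of_pos (mul_pos ha hb)]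
  have key := abs_tsum_gaussWeight_sub_le (A := |g 0| + |K|) (C := K / 4)
    (c := fun k => K / ((k + 1) * (k + 2)))
    (e := fun k => K * (1 / 4 + if k = 0 then 1 / (1 + y) - 1 / 4 else 0))
    (F := K * (1 / 4 * 1 + gaussWeight 0 y * (1 / (1 + y) - 1 / 4)))
    (G := fun k : ℕ => g ((k + 1 + x)⁻¹)) (H := fun k : ℕ => g ((k + 1 + y)⁻¹)) hx hy
    (abs_le_mul_sqrt_of_abs_le (hb x hx)) (abs_le_mul_sqrt_of_abs_le (hb y hy)) ?_ ?_ ?_ ?_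
  · refine key.trans (mul_le_mul_of_nonneg_right ?_ (abs_nonneg _))
    have : gaussWeight 0 y * (1 / (1 + y) - 1 / 4) ≤ 3 / 8 := by
      have e : gaussWeight 0 y = 1 / (2 + y) := by
        unfold gaussWeight
        have : 1 + y ≠ 0 := by positivity
        push_cast; field_simp; ring
      have e' : 1 / (2 + y) * (1 / (1 + y) - 1 / 4) = (3 - y) / (4 * ((1 + y) * (2 + y))) := by
        field_simp; ring
      rw [e, e', div_le_iff₀ (by positivity)]
      nlinarith
    nlinarith
  · intro k
    refine (h _ (inv_natCast_add_mem_Icc _ hx0) _ (inv_natCast_add_mem_Icc _ hx0)).trans ?_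
    rw [hdiff _ _ (by positivity) (by positivity), div_eq_mul_inv K]
    refine mul_le_mul_of_nonneg_left ?_ hK
    have : |(((k + 1 : ℕ) : ℝ) + 1 + x - (k + 1 + x))| = 1 := by push_cast; ring_nf; simp
    rw [this, one_div]
    refine inv_anti₀ (by positivity) ?_
    push_cast
    nlinarith [(Nat.cast_nonneg k : (0 : ℝ) ≤ k)]
  · intro n
    have : ∑ k ∈ Finset.range n, ((k : ℝ) + 1) / (k + 2) ^ 2 * (K / ((k + 1) * (k + 2))) ≤
        K * (1 / 4 - 1 / (2 * ((n + 1) * (n + 2)))) := by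
      -- Compare `1 / (k + 2) ^ 3` with the telescoping `1 / ((k + 1) (k + 2) (k + 3))`.
      induction n with
      | zero => norm_num
      | succ n ih =>
        rw [Finset.sum_range_succ]
        refine (add_le_add_left ih _).trans ?_
        have e : ((n : ℝ) + 1) / (n + 2) ^ 2 * (K / ((n + 1) * (n + 2))) = K * (1 / (n + 2) ^ 3) := by
          field_simp
        rw [e, ← mul_add]
        refine mul_le_mul_of_nonneg_left ?_ hK
        have e2 : 1 / (2 * (((n : ℝ) + 1) * (n + 2))) - 1 / (2 * (((n + 1 : ℕ) + 1) * ((n + 1 : ℕ) + 2)))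
            = 1 / ((n + 1) * (n + 2) * (n + 3)) := by
          push_cast; field_simp; ring
        have e3 : 1 / ((n : ℝ) + 2) ^ 3 ≤ 1 / ((n + 1) * (n + 2) * (n + 3)) := by
          refine one_div_le_one_div_of_le (by positivity) ?_
          nlinarith [(Nat.cast_nonneg n : (0 : ℝ) ≤ n)]
        linarith
    refine this.trans ?_
    have : 0 ≤ K * (1 / (2 * (((n : ℝ) + 1) * (n + 2)))) := by positivity
    linarith
  · intro k
    refine (h _ (inv_natCast_add_mem_Icc _ hx0) _ (inv_natCast_add_mem_Icc _ hy0)).trans ?_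
    rw [hdiff _ _ (by positivity) (by positivity), mul_assoc]
    refine mul_le_mul_of_nonneg_left ?_ hK
    rw [add_sub_add_left_eq_sub, div_eq_mul_inv, mul_comm]
    refine mul_le_mul_of_nonneg_right ?_ (abs_nonneg _)
    rcases k with _ | k
    · simp only [if_true]
      rw [add_sub_cancel, one_div]
      refine inv_anti₀ (by positivity) ?_
      push_cast; nlinarith
    · rw [if_neg (Nat.succ_ne_zero k), add_zero, one_div]
      refine inv_anti₀ (by positivity) ?_
      push_cast
      nlinarith [(Nat.cast_nonneg k : (0 : ℝ) ≤ k), mul_nonneg hx0 hy0]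
  · have h1 := (hasSum_gaussWeight hy0).mul_left (1 / 4)
    have h2 := hasSum_ite_eq (0 : ℕ) (gaussWeight 0 y * (1 / (1 + y) - 1 / 4))
    refine ((h1.add h2).mul_left K).congr_fun ?_
    intro k
    by_cases hk : k = 0
    · subst hk; simp; ring
    · simp [hk]; ring

theorem abs_log_natCast_add_le (k : ℕ) {x : ℝ} (hx : x ∈ Icc (0 : ℝ) 1) :
    |Real.log (k + 1 + x)| ≤ 3 * √(k + 1) := by
  obtain ⟨h0, h1⟩ := hx
  have hk := (Nat.cast_nonneg k : (0 : ℝ) ≤ k)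
  rw [abs_of_nonneg (Real.log_nonneg (by linarith))]
  have hp : (0 : ℝ) < k + 1 + x := by positivity
  have e : Real.log (k + 1 + x) = 2 * Real.log (√(k + 1 + x)) := by
    rw [Real.log_sqrt hp.le]; ring
  have h2 := Real.log_le_sub_one_of_pos (Real.sqrt_pos.2 hp)
  have h3 : √(k + 1 + x) ≤ 3 / 2 * √(k + 1) := by
    rw [Real.sqrt_le_left (by positivity), mul_pow, Real.sq_sqrt (by positivity)]
    linarith
  linarith

theorem neg_log_inv (x : ℝ) : -Real.log x⁻¹ = Real.log x := by rw [Real.log_inv, neg_neg]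

/-- One application of the transfer operator makes the observable `-log x` Lipschitz. -/
theorem lipUnit_gaussOp_neg_log : LipUnit 2 (gaussOp fun x => -Real.log x) := by
  intro x hx y hy
  have hx0 := hx.1
  have hy0 := hy.1
  have hlog (a b : ℝ) (ha : 1 ≤ a) (hb : 1 ≤ b) : Real.log a - Real.log b ≤ |a - b| := by
    rw [← Real.log_div (by positivity) (by positivity)]
    refine (Real.log_le_sub_one_of_pos (by positivity)).trans ?_
    rw [div_sub_one (by positivity), div_le_iff₀ (by positivity)]
    nlinarith [le_abs_self (a - b), abs_nonneg (a - b)]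
  unfold gaussOp
  simp_rw [neg_log_inv]
  have key := abs_tsum_gaussWeight_sub_le (A := 3) (C := 1) (c := fun k => 1 / ((k : ℝ) + 1))
    (e := fun k => 1) (F := 1 * 1)
    (G := fun k : ℕ => Real.log (k + 1 + x)) (H := fun k : ℕ => Real.log (k + 1 + y)) hx hy
    (fun k => abs_log_natCast_add_le k hx) (fun k => abs_log_natCast_add_le k hy) ?_ ?_ ?_
    ((hasSum_gaussWeight hy0).mul_right 1)
  · norm_num at key ⊢; exact key
  · intro k
    have hk := (Nat.cast_nonneg k : (0 : ℝ) ≤ k)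
    have hle : Real.log (k + 1 + x) ≤ Real.log ((k + 1 : ℕ) + 1 + x) :=
      Real.log_le_log (by positivity) (by push_cast; linarith)
    rw [abs_of_nonneg (by linarith), ← Real.log_div (by positivity) (by positivity)]
    refine (Real.log_le_sub_one_of_pos (by positivity)).trans ?_
    have e : ((k + 1 : ℕ) : ℝ) + 1 + x - (k + 1 + x) = 1 := by push_cast; ring
    rw [div_sub_one (by positivity), e]
    exact one_div_le_one_div_of_le (by positivity) (by linarith)
  · intro n
    have : ∑ k ∈ Finset.range n, ((k : ℝ) + 1) / (k + 2) ^ 2 * (1 / ((k : ℝ) + 1)) ≤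
        1 - 1 / ((n : ℝ) + 1) := by
      induction n with
      | zero => norm_num
      | succ n ih =>
        rw [Finset.sum_range_succ]
        refine (add_le_add_left ih _).trans ?_
        have e : ((n : ℝ) + 1) / (n + 2) ^ 2 * (1 / (n + 1)) = 1 / (n + 2) ^ 2 := by
          field_simp
        have e2 : 1 / ((n : ℝ) + 1) - 1 / ((n + 1 : ℕ) + 1) = 1 / ((n + 1) * (n + 2)) := by
          push_cast; field_simp; ring
        have e3 : 1 / ((n : ℝ) + 2) ^ 2 ≤ 1 / ((n + 1) * (n + 2)) := by
          refine one_div_le_one_div_of_le (by positivity) ?_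
          nlinarith [(Nat.cast_nonneg n : (0 : ℝ) ≤ n)]
        linarith
    refine this.trans ?_
    have : 0 ≤ (1 / ((n : ℝ) + 1)) := by positivity
    linarith
  · intro k
    have hk := (Nat.cast_nonneg k : (0 : ℝ) ≤ k)
    rw [one_mul, abs_le]
    have h1 := hlog (k + 1 + x) (k + 1 + y) (by linarith) (by linarith)
    have h2 := hlog (k + 1 + y) (k + 1 + x) (by linarith) (by linarith)
    rw [add_sub_add_left_eq_sub] at h1 h2
    rw [abs_sub_comm] at h2
    constructor <;> linarith

/-! ### Change of variables and the Gauss measure -/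

theorem injOn_inv_natCast_add (k : ℕ) :
    InjOn (fun y : ℝ => ((k : ℝ) + 1 + y)⁻¹) (Ico 0 1) := by
  intro y _ z _ h
  simpa using inv_injective h

theorem iUnion_image_inv_natCast_add :
    ⋃ k : ℕ, (fun y : ℝ => ((k : ℝ) + 1 + y)⁻¹) '' Ico 0 1 = Ioc 0 1 := by
  ext x
  simp only [mem_iUnion, mem_image]
  constructor
  · rintro ⟨k, y, hy, rfl⟩
    have := hy.1
    exact ⟨by positivity, (inv_natCast_add_mem_Icc k hy.1).2⟩
  · rintro ⟨h0, h1⟩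
    have h2 : 1 ≤ x⁻¹ := (one_le_inv₀ h0).2 h1
    have h3 : 1 ≤ ⌊x⁻¹⌋₊ := Nat.le_floor (by simpa using h2)
    refine ⟨⌊x⁻¹⌋₊ - 1, x⁻¹ - ⌊x⁻¹⌋₊, ⟨?_, ?_⟩, ?_⟩
    · linarith [Nat.floor_le (zero_le_one.trans h2)]
    · linarith [Nat.lt_floor_add_one x⁻¹]
    · rw [Nat.cast_sub h3]
      simp

theorem pairwise_disjoint_image_inv_natCast_add :
    Pairwise (Function.onFun Disjoint
      fun k : ℕ => (fun y : ℝ => ((k : ℝ) + 1 + y)⁻¹) '' Ico 0 1) := by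
  intro j k hjk
  refine Set.disjoint_left.2 ?_
  rintro _ ⟨y, hy, rfl⟩ ⟨z, hz, h⟩
  have h' := inv_injective h
  have h1 := hy.1
  have h2 := hy.2
  have h3 := hz.1
  have h4 := hz.2
  rcases lt_or_gt_of_ne hjk with h | h
  · have : (j : ℝ) + 1 ≤ k := by exact_mod_cast h
    linarith
  · have : (k : ℝ) + 1 ≤ j := by exact_mod_cast h
    linarith

/-- Change of variables along the inverse branches `y ↦ 1 / (a + y)` of the Gauss map. -/
theorem lintegral_Ico_eq_tsum_inv_natCast_add (H : ℝ → ENNReal) :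
    ∫⁻ x in Ico (0 : ℝ) 1, H x = ∑' k : ℕ, ∫⁻ y in Ico (0 : ℝ) 1,
      ENNReal.ofReal (1 / ((k : ℝ) + 1 + y) ^ 2) * H (((k : ℝ) + 1 + y)⁻¹) := by
  have hd (k : ℕ) : ∀ y ∈ Ico (0 : ℝ) 1, HasDerivWithinAt (fun y : ℝ => ((k : ℝ) + 1 + y)⁻¹)
      (-1 / ((k : ℝ) + 1 + y) ^ 2) (Ico 0 1) y := by
    intro y hy
    have := hy.1
    exact (((hasDerivAt_id y).const_add ((k : ℝ) + 1)).inv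
      (by simp only [id]; positivity)).hasDerivWithinAt
  rw [setLIntegral_congr Ico_ae_eq_Ioc, ← iUnion_image_inv_natCast_add,
    lintegral_iUnion _ pairwise_disjoint_image_inv_natCast_add]
  · refine tsum_congr fun k => ?_
    rw [lintegral_image_eq_lintegral_abs_deriv_mul measurableSet_Ico (hd k)
      (injOn_inv_natCast_add k)]
    refine setLIntegral_congr_fun measurableSet_Ico fun y hy => ?_
    rw [neg_div, abs_neg, abs_of_nonneg (by positivity)]
  · intro k
    exact measurableSet_Ico.image_of_continuousOn_injOn
      (fun y hy => (hd k y hy).continuousWithinAt) (injOn_inv_natCast_add k)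

theorem measurable_gaussWeight (k : ℕ) : Measurable (gaussWeight k) := by
  unfold gaussWeight; fun_prop

theorem Measurable.gaussOp {g : ℝ → ℝ} (hg : Measurable g) : Measurable (gaussOp g) :=
  Measurable.tsum fun k => (measurable_gaussWeight k).mul (hg.comp (by fun_prop))

/-- The Gauss density `1 / (1 + x)` turns the Jacobian of a branch into `gaussWeight`. -/
theorem inv_sq_mul_div_one_add_inv (k : ℕ) {y : ℝ} (hy : 0 ≤ y) (c : ℝ) :
    1 / ((k : ℝ) + 1 + y) ^ 2 * (c / (1 + ((k : ℝ) + 1 + y)⁻¹)) =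
      gaussWeight k y * c / (1 + y) := by
  unfold gaussWeight
  have h1 : (k : ℝ) + 1 + y ≠ 0 := by positivity
  have h2 : (k : ℝ) + 2 + y ≠ 0 := by positivity
  have h3 : 1 + y ≠ 0 := by positivity
  have h4 : (k : ℝ) + 1 + y + 1 ≠ 0 := by positivity
  have h5 : 1 + ((k : ℝ) + 1 + y)⁻¹ = (k + 2 + y) / (k + 1 + y) := by field_simp; ring
  rw [h5]
  field_simp

/-- The Gauss measure is invariant under the transfer operator. -/
theorem lintegral_gaussOp_div {g : ℝ → ℝ} (hg : Measurable g)
    (h0 : ∀ x ∈ Icc (0 : ℝ) 1, 0 ≤ g x)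
    (hs : ∀ x ∈ Icc (0 : ℝ) 1, Summable fun k : ℕ => gaussWeight k x * g ((k + 1 + x)⁻¹)) :
    ∫⁻ x in Ico (0 : ℝ) 1, ENNReal.ofReal (gaussOp g x / (1 + x)) =
      ∫⁻ x in Ico (0 : ℝ) 1, ENNReal.ofReal (g x / (1 + x)) := by
  symm
  rw [lintegral_Ico_eq_tsum_inv_natCast_add, ← lintegral_tsum]
  · symm
    refine setLIntegral_congr_fun measurableSet_Ico fun y hy => ?_
    have hy' : y ∈ Icc (0 : ℝ) 1 := Ico_subset_Icc_self hy
    rw [gaussOp, ← tsum_div_const, ENNReal.ofReal_tsum_of_nonneg _ ((hs y hy').div_const _)]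
    · refine tsum_congr fun k => ?_
      rw [← ENNReal.ofReal_mul (by positivity), inv_sq_mul_div_one_add_inv k hy.1]
    · intro k
      have := h0 _ (inv_natCast_add_mem_Icc k hy.1)
      have := gaussWeight_nonneg k hy.1
      have := hy.1
      positivity
  · intro k
    refine Measurable.aemeasurable ?_
    have : Measurable fun y : ℝ => ((k : ℝ) + 1 + y)⁻¹ := by fun_prop
    have := hg.comp this
    refine Measurable.mul (by fun_prop) (ENNReal.measurable_ofReal.comp ?_)
    exact this.div (by fun_prop)

/-! ### The Gauss mean of `-log` -/

theorem integral_pow_mul_neg_log (n : ℕ) :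
    IntegrableOn (fun x : ℝ => x ^ n * -Real.log x) (Ioc 0 1) ∧
      ∫ x in Ioc (0 : ℝ) 1, x ^ n * -Real.log x = 1 / ((n : ℝ) + 1) ^ 2 := by
  set F : ℝ → ℝ := fun x =>
    x ^ (n + 1) / ((n : ℝ) + 1) ^ 2 - x ^ n * (x * Real.log x) / ((n : ℝ) + 1) with hF
  have hc : ContinuousOn F (Icc 0 1) := by
    have := Real.continuous_mul_log
    exact Continuous.continuousOn (by fun_prop)
  have hd : ∀ x ∈ Ioo (0 : ℝ) 1, HasDerivAt F (x ^ n * -Real.log x) x := by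
    intro x hx
    have hx0 := hx.1.ne'
    have h1 := (hasDerivAt_pow (n + 1) x).div_const (((n : ℝ) + 1) ^ 2)
    have h2 := ((hasDerivAt_pow (n + 1) x).mul (Real.hasDerivAt_log hx0)).div_const ((n : ℝ) + 1)
    have h3 := h1.sub h2
    refine (h3.congr_deriv ?_).congr_of_eventuallyEq (Eventually.of_forall fun z => ?_)
    · have : (n : ℝ) + 1 ≠ 0 := by positivity
      push_cast
      field_simp
      ring
    · simp only [hF, Pi.sub_apply, Pi.mul_apply]; ring
  have h0 : ∀ x ∈ Ioo (0 : ℝ) 1, 0 ≤ x ^ n * -Real.log x := by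
    intro x hx
    have := Real.log_nonpos hx.1.le hx.2.le
    have := hx.1.le
    exact mul_nonneg (by positivity) (by linarith)
  have hi := intervalIntegral.integrableOn_deriv_of_nonneg hc hd h0
  refine ⟨hi, ?_⟩
  rw [← intervalIntegral.integral_of_le zero_le_one,
    intervalIntegral.integral_eq_sub_of_hasDerivAt_of_le zero_le_one hc hd
      ((intervalIntegrable_iff_integrableOn_Ioc_of_le zero_le_one).2 hi)]
  simp [hF]

theorem hasSum_inv_odd_sq_sub_inv_even_sq :
    HasSum (fun k : ℕ => 1 / ((2 * k : ℕ) + 1 : ℝ) ^ 2 - 1 / ((2 * k + 1 : ℕ) + 1 : ℝ) ^ 2)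
      (Real.pi ^ 2 / 12) := by
  have hz := hasSum_zeta_two
  have he : HasSum (fun k : ℕ => 1 / ((2 * k : ℕ) : ℝ) ^ 2) (1 / 4 * (Real.pi ^ 2 / 6)) := by
    refine (hz.mul_left (1 / 4)).congr_fun fun k => ?_
    push_cast
    rw [mul_pow, one_div_mul_one_div]
    norm_num
  have ho' : Summable fun k : ℕ => 1 / ((2 * k + 1 : ℕ) : ℝ) ^ 2 :=
    hz.summable.comp_injective (i := fun k : ℕ => 2 * k + 1) fun a b h => by
      have : 2 * a + 1 = 2 * b + 1 := h
      omega
  obtain ⟨s, ho⟩ := ho'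
  have hsum := (HasSum.even_add_odd (f := fun n : ℕ => 1 / (n : ℝ) ^ 2) he ho).unique hz
  have he2 := (hasSum_nat_add_iff' 1).2 he
  have := ho.sub he2
  have hv : s - (1 / 4 * (Real.pi ^ 2 / 6) -
      ∑ i ∈ Finset.range 1, 1 / ((2 * i : ℕ) : ℝ) ^ 2) = Real.pi ^ 2 / 12 := by
    simp; linarith
  rw [hv] at this
  refine this.congr_fun fun k => ?_
  push_cast
  ring

/-- The integral of `-log x` against the unnormalised Gauss density, by expanding `1 / (1 + x)` as
`∑ (x ^ (2 k) - x ^ (2 k + 1))`, which has nonnegative terms. -/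
theorem lintegral_neg_log_div_one_add :
    ∫⁻ x in Ico (0 : ℝ) 1, ENNReal.ofReal (-Real.log x / (1 + x)) =
      ENNReal.ofReal (Real.pi ^ 2 / 12) := by
  have hnn (k : ℕ) (x : ℝ) (hx : x ∈ Ioo (0 : ℝ) 1) :
      0 ≤ x ^ (2 * k) * -Real.log x - x ^ (2 * k + 1) * -Real.log x := by
    have h1 := Real.log_nonpos hx.1.le hx.2.le
    have h2 : 0 ≤ x ^ (2 * k) := pow_nonneg hx.1.le _
    have h3 : x ^ (2 * k) * -Real.log x - x ^ (2 * k + 1) * -Real.log x =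
      x ^ (2 * k) * (-Real.log x * (1 - x)) := by ring
    rw [h3]
    exact mul_nonneg h2 (mul_nonneg (by linarith) (by linarith [hx.2]))
  have hpt : ∀ x ∈ Ioo (0 : ℝ) 1, ENNReal.ofReal (-Real.log x / (1 + x)) = ∑' k : ℕ,
      ENNReal.ofReal (x ^ (2 * k) * -Real.log x - x ^ (2 * k + 1) * -Real.log x) := by
    intro x hx
    have hg := (hasSum_geometric_of_lt_one (sq_nonneg x)
      (by nlinarith [hx.1, hx.2] : x ^ 2 < 1)).mul_right (-Real.log x * (1 - x))
    have hg' : HasSum (fun k : ℕ => x ^ (2 * k) * -Real.log x - x ^ (2 * k + 1) * -Real.log x)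
        (-Real.log x / (1 + x)) := by
      have e : -Real.log x / (1 + x) = (1 - x ^ 2)⁻¹ * (-Real.log x * (1 - x)) := by
        have h1 : 1 + x ≠ 0 := by linarith [hx.1]
        have h2 : 1 - x ≠ 0 := by linarith [hx.2]
        have h3 : 1 - x ^ 2 = (1 - x) * (1 + x) := by ring
        rw [h3]
        field_simp
      rw [e]
      refine hg.congr_fun fun k => ?_
      rw [← pow_mul]; ring
    rw [← hg'.tsum_eq, ENNReal.ofReal_tsum_of_nonneg (fun k => hnn k x hx) hg'.summable]
  have hint (k : ℕ) : ∫⁻ x in Ioo (0 : ℝ) 1,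
      ENNReal.ofReal (x ^ (2 * k) * -Real.log x - x ^ (2 * k + 1) * -Real.log x) =
      ENNReal.ofReal (1 / ((2 * k : ℕ) + 1 : ℝ) ^ 2 - 1 / ((2 * k + 1 : ℕ) + 1 : ℝ) ^ 2) := by
    obtain ⟨i1, e1⟩ := integral_pow_mul_neg_log (2 * k)
    obtain ⟨i2, e2⟩ := integral_pow_mul_neg_log (2 * k + 1)
    rw [← e1, ← e2, ← integral_sub i1 i2, integral_Ioc_eq_integral_Ioo,
      ofReal_integral_eq_lintegral_ofReal]
    · exact (i1.sub i2).mono_set Ioo_subset_Ioc_self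
    · exact (ae_restrict_iff' measurableSet_Ioo).2 (Eventually.of_forall fun x hx => hnn k x hx)
  rw [setLIntegral_congr (Ioo_ae_eq_Ico (a := (0 : ℝ)) (b := 1)).symm,
    setLIntegral_congr_fun measurableSet_Ioo hpt, lintegral_tsum]
  · simp_rw [hint]
    rw [← hasSum_inv_odd_sq_sub_inv_even_sq.tsum_eq, ENNReal.ofReal_tsum_of_nonneg _
      hasSum_inv_odd_sq_sub_inv_even_sq.summable]
    intro k
    rw [sub_nonneg]
    refine one_div_le_one_div_of_le (by positivity) ?_
    gcongr
    simp
  · intro k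
    have := Real.measurable_log
    exact Measurable.aemeasurable (by fun_prop)

theorem lintegral_const_div_one_add (b : ℝ) :
    ∫⁻ x in Ico (0 : ℝ) 1, ENNReal.ofReal (b / (1 + x)) = ENNReal.ofReal (b * Real.log 2) := by
  rcases le_total b 0 with hb | hb
  · have h2 : b * Real.log 2 ≤ 0 := mul_nonpos_of_nonpos_of_nonneg hb (Real.log_nonneg (by norm_num))
    rw [ENNReal.ofReal_of_nonpos h2, setLIntegral_congr_fun (g := fun _ => 0) measurableSet_Ico]
    · simp
    · intro x hx
      have := hx.1
      exact ENNReal.ofReal_of_nonpos (div_nonpos_of_nonpos_of_nonneg hb (by positivity))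
  · have hc : ContinuousOn (fun x : ℝ => b / (1 + x)) (Icc 0 1) :=
      ContinuousOn.div (by fun_prop) (by fun_prop) fun x hx => by
        have := hx.1
        positivity
    have hd : ∀ x ∈ uIcc (0 : ℝ) 1, HasDerivAt (fun x => b * Real.log (1 + x)) (b / (1 + x)) x := by
      intro x hx
      rw [uIcc_of_le zero_le_one] at hx
      have h1 : 1 + x ≠ 0 := by have := hx.1; positivity
      refine ((((hasDerivAt_id x).const_add 1).log h1).const_mul b).congr_deriv ?_
      simp [div_eq_mul_inv]
    have hi : ∫ x in Ioc (0 : ℝ) 1, b / (1 + x) = b * Real.log 2 := by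
      rw [← intervalIntegral.integral_of_le zero_le_one,
        intervalIntegral.integral_eq_sub_of_hasDerivAt hd]
      · norm_num
      · exact ContinuousOn.intervalIntegrable_of_Icc zero_le_one hc
    rw [← hi, setLIntegral_congr Ico_ae_eq_Ioc, ofReal_integral_eq_lintegral_ofReal]
    · exact (hc.integrableOn_Icc).mono_set Ioc_subset_Icc_self
    · refine (ae_restrict_iff' measurableSet_Ioc).2 (Eventually.of_forall fun x hx => ?_)
      have := hx.1
      simp only [Pi.zero_apply]
      positivity

/-! ### Convergence of the iterates of the transfer operator -/

/-- `gaussIter k` is the conditional mean of `-log` after `k + 1` steps of the dual chain, as a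
function of its starting point. -/
noncomputable def gaussIter (k : ℕ) : ℝ → ℝ := gaussOp^[k + 1] fun x => -Real.log x

theorem gaussIter_zero : gaussIter 0 = gaussOp fun x => -Real.log x := rfl

theorem gaussIter_succ (k : ℕ) : gaussIter (k + 1) = gaussOp (gaussIter k) :=
  Function.iterate_succ_apply' _ _ _

theorem lipUnit_gaussIter (k : ℕ) : LipUnit (2 * (7 / 8) ^ k) (gaussIter k) := by
  induction k with
  | zero => simpa [gaussIter_zero] using lipUnit_gaussOp_neg_log
  | succ k ih =>
    rw [gaussIter_succ]
    convert ih.gaussOp using 1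
    ring

theorem measurable_gaussIter (k : ℕ) : Measurable (gaussIter k) := by
  induction k with
  | zero => exact Measurable.gaussOp Real.measurable_log.neg
  | succ k ih => rw [gaussIter_succ]; exact ih.gaussOp

theorem gaussOp_nonneg {g : ℝ → ℝ} (h0 : ∀ x ∈ Icc (0 : ℝ) 1, 0 ≤ g x) :
    ∀ x ∈ Icc (0 : ℝ) 1, 0 ≤ gaussOp g x := fun _ hx =>
  tsum_nonneg fun k => mul_nonneg (gaussWeight_nonneg k hx.1)
    (h0 _ (inv_natCast_add_mem_Icc k hx.1))

theorem neg_log_nonneg_of_mem_Icc (x : ℝ) (hx : x ∈ Icc (0 : ℝ) 1) : 0 ≤ -Real.log x :=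
  neg_nonneg.2 (Real.log_nonpos hx.1 hx.2)

theorem gaussIter_nonneg (k : ℕ) : ∀ x ∈ Icc (0 : ℝ) 1, 0 ≤ gaussIter k x := by
  induction k with
  | zero => exact gaussOp_nonneg neg_log_nonneg_of_mem_Icc
  | succ k ih => rw [gaussIter_succ]; exact gaussOp_nonneg ih

theorem LipUnit.summable_gaussWeight_mul {K : ℝ} {g : ℝ → ℝ} (h : LipUnit K g) {x : ℝ}
    (hx : x ∈ Icc (0 : ℝ) 1) : Summable fun k : ℕ => gaussWeight k x * g ((k + 1 + x)⁻¹) :=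
  _root_.summable_gaussWeight_mul hx
    (abs_le_mul_sqrt_of_abs_le fun k => h.abs_le (inv_natCast_add_mem_Icc k hx.1))

theorem lintegral_gaussIter_div (k : ℕ) :
    ∫⁻ x in Ico (0 : ℝ) 1, ENNReal.ofReal (gaussIter k x / (1 + x)) =
      ENNReal.ofReal (Real.pi ^ 2 / 12) := by
  induction k with
  | zero =>
    rw [gaussIter_zero, lintegral_gaussOp_div (g := fun x => -Real.log x) Real.measurable_log.neg
      neg_log_nonneg_of_mem_Icc,
      lintegral_neg_log_div_one_add]
    intro x hx
    simp_rw [neg_log_inv]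
    exact summable_gaussWeight_mul hx fun k => abs_log_natCast_add_le k hx
  | succ k ih =>
    rw [gaussIter_succ, lintegral_gaussOp_div (measurable_gaussIter k) (gaussIter_nonneg k), ih]
    exact fun x hx => (lipUnit_gaussIter k).summable_gaussWeight_mul hx

/-- Lévy's constant, `π² / (12 log 2)`: the mean of `-log` under the Gauss measure. -/
noncomputable def levyConst : ℝ := Real.pi ^ 2 / (12 * Real.log 2)

/-- The conditional means of `-log` converge to Lévy's constant, uniformly and exponentially:
their oscillation decays by the spectral gap, and their Gauss mean does not change. -/
theorem abs_gaussIter_sub_levyConst_le (k : ℕ) {x : ℝ} (hx : x ∈ Icc (0 : ℝ) 1) :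
    |gaussIter k x - levyConst| ≤ 2 * (7 / 8) ^ k := by
  have hl : 0 < Real.log 2 := Real.log_pos (by norm_num)
  -- The oscillation on the unit interval is at most the Lipschitz constant.
  have hosc (y : ℝ) (hy : y ∈ Ico (0 : ℝ) 1) : |gaussIter k y - gaussIter k x| ≤ 2 * (7 / 8) ^ k := by
    refine (lipUnit_gaussIter k y (Ico_subset_Icc_self hy) x hx).trans ?_
    have : |y - x| ≤ 1 := by
      rw [abs_le]; constructor <;> linarith [hy.1, hy.2, hx.1, hx.2]
    exact mul_le_of_le_one_right (by positivity) this
  have hint := lintegral_gaussIter_div k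
  have hL : levyConst * Real.log 2 = Real.pi ^ 2 / 12 := by
    unfold levyConst; field_simp
  rw [← hL] at hint
  have hL0 : 0 < levyConst := by unfold levyConst; positivity
  have hup : ENNReal.ofReal (levyConst * Real.log 2) ≤
      ENNReal.ofReal ((gaussIter k x + 2 * (7 / 8) ^ k) * Real.log 2) := by
    rw [← hint, ← lintegral_const_div_one_add]
    refine setLIntegral_mono' measurableSet_Ico fun y hy => ENNReal.ofReal_le_ofReal ?_
    have := hy.1
    gcongr
    linarith [(abs_le.1 (hosc y hy)).2]
  have hlo : ENNReal.ofReal ((gaussIter k x - 2 * (7 / 8) ^ k) * Real.log 2) ≤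
      ENNReal.ofReal (levyConst * Real.log 2) := by
    rw [← hint, ← lintegral_const_div_one_add]
    refine setLIntegral_mono' measurableSet_Ico fun y hy => ENNReal.ofReal_le_ofReal ?_
    have := hy.1
    gcongr
    linarith [(abs_le.1 (hosc y hy)).1]
  have h3 : 0 ≤ (gaussIter k x + 2 * (7 / 8) ^ k) * Real.log 2 := by
    have := gaussIter_nonneg k x hx
    positivity
  rw [ENNReal.ofReal_le_ofReal_iff h3] at hup
  rw [ENNReal.ofReal_le_ofReal_iff (by positivity)] at hlo
  have h1 := le_of_mul_le_mul_right hup hl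
  have h2 := le_of_mul_le_mul_right hlo hl
  rw [abs_le]
  constructor <;> linarith

/-! ### The tilted transfer operator -/

/-- An approximate solution `u` of the Poisson equation `u - gaussOp u = gaussOp (-log) - λ`, with
`λ` Lévy's constant: a truncated Neumann series. -/
theorem exists_approx_poisson_solution {ε : ℝ} (hε : 0 < ε) :
    ∃ (u : ℝ → ℝ) (U : ℝ), Measurable u ∧ 0 ≤ U ∧ (∀ x ∈ Icc (0 : ℝ) 1, |u x| ≤ U) ∧
      ∀ x ∈ Icc (0 : ℝ) 1, ∃ v, |v - levyConst - u x| ≤ ε ∧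
        HasSum (fun k : ℕ =>
          gaussWeight k x * (Real.log (k + 1 + x) + u ((k + 1 + x)⁻¹))) v := by
  obtain ⟨N, hN⟩ : ∃ N : ℕ, (7 / 8 : ℝ) ^ N < ε / 2 :=
    exists_pow_lt_of_lt_one (by positivity) (by norm_num)
  refine ⟨fun x => ∑ k ∈ Finset.range N, (gaussIter k x - levyConst),
    ∑ k ∈ Finset.range N, 2 * (7 / 8) ^ k, ?_, by positivity, fun x hx => ?_, fun x hx => ?_⟩
  · exact Finset.measurable_fun_sum _ fun k _ => (measurable_gaussIter k).sub_const _
  · exact (Finset.abs_sum_le_sum_abs _ _).trans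
      (Finset.sum_le_sum fun k _ => abs_gaussIter_sub_levyConst_le k hx)
  · refine ⟨gaussIter 0 x + ∑ k ∈ Finset.range N, (gaussIter (k + 1) x - levyConst), ?_, ?_⟩
    · have e := Finset.sum_range_sub (fun k => gaussIter k x) N
      have : gaussIter 0 x + ∑ k ∈ Finset.range N, (gaussIter (k + 1) x - levyConst) - levyConst -
          ∑ k ∈ Finset.range N, (gaussIter k x - levyConst) = gaussIter N x - levyConst := by
        simp only [Finset.sum_sub_distrib] at e ⊢
        linarith
      rw [this]
      linarith [abs_gaussIter_sub_levyConst_le N hx]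
    · simp_rw [mul_add]
      refine HasSum.add ?_ ?_
      · have := (summable_gaussWeight_mul hx fun k => abs_log_natCast_add_le k hx).hasSum
        simpa only [gaussIter_zero, gaussOp, neg_log_inv] using this
      · simp_rw [Finset.mul_sum]
        refine hasSum_sum fun j _ => ?_
        have h1 := ((lipUnit_gaussIter j).summable_gaussWeight_mul hx).hasSum
        have h2 := (hasSum_gaussWeight hx.1).mul_right levyConst
        rw [one_mul] at h2
        rw [gaussIter_succ]
        simp_rw [mul_sub]
        exact h1.sub h2

theorem exp_le_one_add_add_sq_mul_exp_abs (s : ℝ) :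
    Real.exp s ≤ 1 + s + s ^ 2 * Real.exp |s| := by
  have h := Complex.norm_exp_sub_sum_le_norm_mul_exp (s : ℂ) 2
  have e : Complex.exp s - ∑ m ∈ Finset.range 2, (s : ℂ) ^ m / (m.factorial : ℂ) =
      ((Real.exp s - (1 + s) : ℝ) : ℂ) := by
    simp [Finset.sum_range_succ]
  rw [e, Complex.norm_real, Complex.norm_real, Real.norm_eq_abs, Real.norm_eq_abs, sq_abs] at h
  linarith [le_abs_self (Real.exp s - (1 + s))]

theorem exp_half_log_le (k : ℕ) {x : ℝ} (hx : x ∈ Icc (0 : ℝ) 1) :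
    Real.exp (Real.log (k + 1 + x) / 2) ≤ 2 * √(k + 1) := by
  obtain ⟨h0, h1⟩ := hx
  have hp : (0 : ℝ) < k + 1 + x := by positivity
  rw [← Real.log_sqrt hp.le, Real.exp_log (Real.sqrt_pos.2 hp),
    Real.sqrt_le_left (by positivity), mul_pow, Real.sq_sqrt (by positivity)]
  linarith [(Nat.cast_nonneg k : (0 : ℝ) ≤ k)]

/-- One term of the tilted transfer operator, to first order in `t`. Here `l` is the logarithm of
the branch, `a` the value of the corrector and `s` the square root of the digit. -/
theorem exp_mul_mul_one_add_le {t l a U s : ℝ} (hl : 0 ≤ l) (ht1 : |t| ≤ 1 / 4)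
    (hlog : l ≤ 3 * s) (hq : Real.exp (l / 2) ≤ 2 * s) (hu1 : |a| ≤ U) (hta : |t * a| ≤ 1 / 2) :
    Real.exp (t * l) * (1 + t * a) ≤ 1 + t * (l + a) + t ^ 2 * (3 * U + 192) * s := by
  have hs0 : 0 ≤ s := by linarith [Real.exp_pos (l / 2)]
  have hU0 : 0 ≤ U := (abs_nonneg a).trans hu1
  have hh1 : 0 ≤ 1 + t * a ∧ 1 + t * a ≤ 3 / 2 := by
    have := abs_le.1 hta
    constructor <;> linarith
  -- The second-order remainder is absorbed by `exp (l / 2)`, as `|t| ≤ 1 / 4`.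
  have hquad : l ^ 2 * Real.exp |t * l| ≤ 128 * s := by
    have h1 : l ≤ 8 * Real.exp (l / 8) := by linarith [Real.add_one_le_exp (l / 8)]
    have h2 : l ^ 2 ≤ 64 * Real.exp (l / 4) := by
      have : Real.exp (l / 4) = Real.exp (l / 8) ^ 2 := by
        rw [← Real.exp_nat_mul]; congr 1; push_cast; ring
      rw [this]; nlinarith [Real.exp_pos (l / 8)]
    have h3 : Real.exp |t * l| ≤ Real.exp (l / 4) := by
      refine Real.exp_le_exp.2 ?_
      rw [abs_mul, abs_of_nonneg hl]; nlinarith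
    calc l ^ 2 * Real.exp |t * l| ≤ 64 * Real.exp (l / 4) * Real.exp (l / 4) := by gcongr
      _ = 64 * Real.exp (l / 2) := by rw [mul_assoc, ← Real.exp_add]; congr 2; ring
      _ ≤ _ := by linarith
  have hexp := exp_le_one_add_add_sq_mul_exp_abs (t * l)
  have hexp' : Real.exp (t * l) ≤ 1 + t * l + t ^ 2 * (128 * s) := by
    rw [mul_pow, mul_assoc] at hexp
    nlinarith [mul_le_mul_of_nonneg_left hquad (sq_nonneg t)]
  have h1 : Real.exp (t * l) * (1 + t * a) ≤
      (1 + t * l + t ^ 2 * (128 * s)) * (1 + t * a) :=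
    mul_le_mul_of_nonneg_right hexp' hh1.1
  have h2 : t ^ 2 * (128 * s) * (1 + t * a) ≤ t ^ 2 * (128 * s) * (3 / 2) :=
    mul_le_mul_of_nonneg_left hh1.2 (by positivity)
  have h3 : l * a ≤ 3 * s * U :=
    (mul_le_mul_of_nonneg_left ((le_abs_self a).trans hu1) hl).trans
      (mul_le_mul_of_nonneg_right hlog hU0)
  have h4 := mul_le_mul_of_nonneg_left h3 (sq_nonneg t)
  nlinarith

/-- The comparison closing the supersolution estimate: the approximate Poisson equation for `w`
cancels the first-order terms, and the margin `|t| * ε` absorbs its error and the second-order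
terms once `t` is small. -/
theorem one_add_le_exp_mul_one_add {t l a w C U ε : ℝ} (hl : 0 ≤ l) (hε : 0 ≤ ε)
    (hx1 : 1 / 2 ≤ 1 + t * a) (hux : |a| ≤ U) (hw : |w - l - a| ≤ ε / 4)
    (ht3 : |t| * (C + U * l + 1) ≤ ε / 4) :
    1 + t * w + t ^ 2 * C ≤ Real.exp (t * l + |t| * ε) * (1 + t * a) := by
  have htw : t * (w - l - a) ≤ |t| * (ε / 4) := by
    refine (le_abs_self _).trans ?_
    rw [abs_mul]
    exact mul_le_mul_of_nonneg_left hw (abs_nonneg t)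
  have hexp := Real.add_one_le_exp (t * l + |t| * ε)
  have h1 := mul_le_mul_of_nonneg_right hexp (by linarith : 0 ≤ 1 + t * a)
  refine le_trans ?_ h1
  have hsq : t ^ 2 = |t| * |t| := by rw [← sq, sq_abs]
  have h2 : |t| * |t| * (C + U * l) ≤ |t| * (ε / 4) := by
    rw [mul_assoc]
    refine mul_le_mul_of_nonneg_left ?_ (abs_nonneg t)
    nlinarith [abs_nonneg t]
  have h3 : -(t ^ 2 * (U * l)) ≤ t ^ 2 * (a * l) := by
    have : -(U * l) ≤ a * l := by nlinarith [(abs_le.1 hux).1]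
    nlinarith [mul_le_mul_of_nonneg_left this (sq_nonneg t)]
  have h4 : |t| * ε * (1 / 2) ≤ |t| * ε * (1 + t * a) :=
    mul_le_mul_of_nonneg_left hx1 (by positivity)
  have h5 : t ^ 2 * C + t ^ 2 * (U * l) ≤ |t| * (ε / 4) := by
    rw [hsq]; linarith
  have h6 : t * w = t * (w - l - a) + t * l + t * a := by ring
  nlinarith

/-- A supersolution of the eigenvalue equation of the tilted transfer operator, close to `1`, with
eigenvalue `exp (t λ + o(t))`. The first-order term in `t` of the supersolution is an approximate
solution of the Poisson equation. -/
theorem exists_tilted_supersolution {ε : ℝ} (hε : 0 < ε) :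
    ∃ t₀ : ℝ, 0 < t₀ ∧ ∀ t : ℝ, |t| ≤ t₀ → ∃ h : ℝ → ℝ, Measurable h ∧
      (∀ x ∈ Icc (0 : ℝ) 1, 1 / 2 ≤ h x ∧ h x ≤ 3 / 2) ∧
      ∀ x ∈ Icc (0 : ℝ) 1, ∃ v, v ≤ Real.exp (t * levyConst + |t| * ε) * h x ∧
        HasSum (fun k : ℕ => gaussWeight k x *
          (Real.exp (t * Real.log (k + 1 + x)) * h ((k + 1 + x)⁻¹))) v := by
  obtain ⟨u, U, hum, hU0, hU, hu⟩ := exists_approx_poisson_solution (ε := ε / 4) (by positivity)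
  have hL0 : 0 < levyConst := by
    have : 0 < Real.log 2 := Real.log_pos (by norm_num)
    unfold levyConst; positivity
  set M : ℝ := ∑' k : ℕ, 2 * ((k : ℝ) + 1) ^ (-(3 / 2) : ℝ) with hM
  have hM0 : 0 ≤ M := tsum_nonneg fun k => by positivity
  set C : ℝ := (3 * U + 192) * M with hC
  have hC0 : 0 ≤ C := by positivity
  refine ⟨min (1 / 4) (min (1 / (2 * (U + 1))) (ε / 4 / (C + U * levyConst + 1))), ?_, ?_⟩
  · refine lt_min (by norm_num) (lt_min (by positivity) (by positivity))
  intro t ht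
  obtain ⟨ht1, ht'⟩ := le_min_iff.1 ht
  obtain ⟨ht2, ht3⟩ := le_min_iff.1 ht'
  rw [le_div_iff₀ (by positivity)] at ht2 ht3
  have htu (x : ℝ) (hx : x ∈ Icc (0 : ℝ) 1) : |t * u x| ≤ 1 / 2 := by
    rw [abs_mul]
    nlinarith [hU x hx, abs_nonneg t, abs_nonneg (u x)]
  have hh (x : ℝ) (hx : x ∈ Icc (0 : ℝ) 1) : 1 / 2 ≤ 1 + t * u x ∧ 1 + t * u x ≤ 3 / 2 := by
    have := abs_le.1 (htu x hx)
    constructor <;> linarith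
  refine ⟨fun x => 1 + t * u x, by fun_prop, hh, fun x hx => ?_⟩
  obtain ⟨w, hw, hws⟩ := hu x hx
  have hl0 (k : ℕ) : 0 ≤ Real.log (k + 1 + x) :=
    Real.log_nonneg (by linarith [(Nat.cast_nonneg k : (0 : ℝ) ≤ k), hx.1])
  have hinv (k : ℕ) := inv_natCast_add_mem_Icc k hx.1
  have hsum : Summable fun k : ℕ => gaussWeight k x *
      (Real.exp (t * Real.log (k + 1 + x)) * (1 + t * u ((k + 1 + x)⁻¹))) := by
    refine summable_gaussWeight_mul (A := 3) hx fun k => ?_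
    have h1 := hh _ (hinv k)
    rw [abs_of_nonneg (mul_nonneg (Real.exp_pos _).le (by linarith))]
    have h2 : Real.exp (t * Real.log (k + 1 + x)) ≤ 2 * √(k + 1) := by
      refine (Real.exp_le_exp.2 ?_).trans (exp_half_log_le k hx)
      nlinarith [hl0 k, le_abs_self t]
    nlinarith [Real.exp_pos (t * Real.log (k + 1 + x)), Real.sqrt_nonneg ((k : ℝ) + 1)]
  refine ⟨_, ?_, hsum.hasSum⟩
  have hterm (k : ℕ) : gaussWeight k x *
      (Real.exp (t * Real.log (k + 1 + x)) * (1 + t * u ((k + 1 + x)⁻¹))) ≤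
      gaussWeight k x + t * (gaussWeight k x * (Real.log (k + 1 + x) + u ((k + 1 + x)⁻¹))) +
        t ^ 2 * (3 * U + 192) * (2 * ((k : ℝ) + 1) ^ (-(3 / 2) : ℝ)) := by
    have hlog := abs_log_natCast_add_le k hx
    rw [abs_of_nonneg (hl0 k)] at hlog
    have hmain := exp_mul_mul_one_add_le (hl0 k) ht1 hlog (exp_half_log_le k hx)
      (hU _ (hinv k)) (htu _ (hinv k))
    have hp := gaussWeight_nonneg k hx.1
    have hps := gaussWeight_mul_sqrt_le k hx
    have h5 := mul_le_mul_of_nonneg_left hmain hp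
    have h6 : t ^ 2 * (3 * U + 192) * (gaussWeight k x * √(k + 1)) ≤
        t ^ 2 * (3 * U + 192) * (2 * ((k : ℝ) + 1) ^ (-(3 / 2) : ℝ)) :=
      mul_le_mul_of_nonneg_left hps (by positivity)
    linarith
  have hright := ((hasSum_gaussWeight hx.1).add (hws.mul_left t)).add
    (summable_two_mul_rpow.hasSum.mul_left (t ^ 2 * (3 * U + 192)))
  have hle := hasSum_le hterm hsum.hasSum hright
  rw [← hM, mul_assoc, ← hC] at hle
  refine hle.trans ?_
  exact one_add_le_exp_mul_one_add hL0.le hε.le (hh x hx).1 (hU x hx) hw ht3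

/-! ### Large deviations of Birkhoff sums -/

/-- The Gauss map `x ↦ 1 / x - ⌊1 / x⌋`, with `0 ↦ 0`. -/
noncomputable def gaussMap (x : ℝ) : ℝ := Int.fract x⁻¹

/-- The Birkhoff sum `-∑ log (T^k x)`, over `k < n`, for the Gauss map `T`. -/
noncomputable def logSum (n : ℕ) (x : ℝ) : ℝ := birkhoffSum gaussMap (fun x => -Real.log x) n x

theorem gaussMap_inv_natCast_add (k : ℕ) {y : ℝ} (hy : y ∈ Ico (0 : ℝ) 1) :
    gaussMap ((k + 1 + y)⁻¹) = y := by
  have : (k : ℝ) + 1 + y = ((k + 1 : ℕ) : ℝ) + y := by push_cast; ring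
  rw [gaussMap, inv_inv, this, Int.fract_natCast_add, Int.fract_eq_self.2 hy]

theorem measurable_logSum (n : ℕ) : Measurable (logSum n) := by
  have h1 : Measurable gaussMap := measurable_fract.comp measurable_inv
  unfold logSum birkhoffSum
  exact Finset.measurable_fun_sum _ fun k _ => (Real.measurable_log.comp (h1.iterate k)).neg

theorem logSum_zero (x : ℝ) : logSum 0 x = 0 := birkhoffSum_zero _ _ _

theorem logSum_succ (n : ℕ) (x : ℝ) : logSum (n + 1) x = -Real.log x + logSum n (gaussMap x) :=
  birkhoffSum_succ' _ _ _ _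

/-- Iterating the transfer operator: a supersolution of the tilted eigenvalue equation bounds the
exponential moments of the Birkhoff sums. -/
theorem lintegral_exp_logSum_le {t κ : ℝ} (hκ : 0 ≤ κ) {h : ℝ → ℝ} (hm : Measurable h)
    (h0 : ∀ x ∈ Icc (0 : ℝ) 1, 0 ≤ h x)
    (hsup : ∀ x ∈ Icc (0 : ℝ) 1, ∃ v, v ≤ κ * h x ∧ HasSum (fun k : ℕ => gaussWeight k x *
      (Real.exp (t * Real.log (k + 1 + x)) * h ((k + 1 + x)⁻¹))) v) (n : ℕ) :
    ∫⁻ x in Ico (0 : ℝ) 1, ENNReal.ofReal (Real.exp (t * logSum n x) * (h x / (1 + x))) ≤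
      ENNReal.ofReal (κ ^ n) * ∫⁻ x in Ico (0 : ℝ) 1, ENNReal.ofReal (h x / (1 + x)) := by
  induction n with
  | zero => simp [logSum_zero]
  | succ n ih =>
    rw [pow_succ', ENNReal.ofReal_mul hκ, mul_assoc]
    refine le_trans ?_ (mul_le_mul_right ih _)
    rw [← lintegral_const_mul' _ _ ENNReal.ofReal_ne_top, lintegral_Ico_eq_tsum_inv_natCast_add,
      ← lintegral_tsum]
    · refine setLIntegral_mono' measurableSet_Ico fun y hy => ?_
      obtain ⟨v, hv, hs⟩ := hsup y (Ico_subset_Icc_self hy)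
      have hy0 := hy.1
      have hs' := (hs.mul_right (1 / (1 + y))).mul_left (Real.exp (t * logSum n y))
      have e (k : ℕ) : ENNReal.ofReal (1 / ((k : ℝ) + 1 + y) ^ 2) *
          ENNReal.ofReal (Real.exp (t * logSum (n + 1) ((k + 1 + y)⁻¹)) *
            (h ((k + 1 + y)⁻¹) / (1 + (k + 1 + y)⁻¹))) =
          ENNReal.ofReal (Real.exp (t * logSum n y) * (gaussWeight k y *
            (Real.exp (t * Real.log (k + 1 + y)) * h ((k + 1 + y)⁻¹)) * (1 / (1 + y)))) := by
        rw [← ENNReal.ofReal_mul (by positivity), logSum_succ, neg_log_inv,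
          gaussMap_inv_natCast_add k hy, mul_add, Real.exp_add]
        congr 1
        have := inv_sq_mul_div_one_add_inv k hy0
          (Real.exp (t * Real.log (k + 1 + y)) * h ((k + 1 + y)⁻¹))
        linear_combination Real.exp (t * logSum n y) * this
      simp_rw [e]
      rw [← ENNReal.ofReal_tsum_of_nonneg _ hs'.summable, hs'.tsum_eq, ← ENNReal.ofReal_mul hκ]
      · refine ENNReal.ofReal_le_ofReal ?_
        calc Real.exp (t * logSum n y) * (v * (1 / (1 + y)))
            ≤ Real.exp (t * logSum n y) * (κ * h y * (1 / (1 + y))) := by gcongr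
          _ = _ := by ring
      · intro k
        have := h0 _ (inv_natCast_add_mem_Icc k hy0)
        have := gaussWeight_nonneg k hy0
        positivity
    · intro k
      have hi : Measurable fun y : ℝ => ((k : ℝ) + 1 + y)⁻¹ := by fun_prop
      have h1 := hm.comp hi
      have h2 := (measurable_logSum (n + 1)).comp hi
      refine Measurable.aemeasurable (Measurable.mul (by fun_prop)
        (ENNReal.measurable_ofReal.comp (Measurable.mul ?_ (h1.div (by fun_prop)))))
      exact Real.measurable_exp.comp (h2.const_mul t)

/-- The exponential Markov inequality for the Birkhoff sums. -/
theorem volume_le_mul_logSum_le {t κ : ℝ} (hκ : 0 ≤ κ) {h : ℝ → ℝ} (hm : Measurable h)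
    (hb : ∀ x ∈ Icc (0 : ℝ) 1, 1 / 2 ≤ h x ∧ h x ≤ 3 / 2)
    (hsup : ∀ x ∈ Icc (0 : ℝ) 1, ∃ v, v ≤ κ * h x ∧ HasSum (fun k : ℕ => gaussWeight k x *
      (Real.exp (t * Real.log (k + 1 + x)) * h ((k + 1 + x)⁻¹))) v) (n : ℕ) (c : ℝ) :
    volume {x : ℝ | x ∈ Ico (0 : ℝ) 1 ∧ c ≤ t * logSum n x} ≤
      ENNReal.ofReal (6 * κ ^ n * Real.exp (-c)) := by
  have h1 := lintegral_exp_logSum_le hκ hm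
    (fun x hx => by linarith [(hb x hx).1]) hsup n
  have h2 : ∫⁻ x in Ico (0 : ℝ) 1, ENNReal.ofReal (h x / (1 + x)) ≤ ENNReal.ofReal (3 / 2) := by
    calc ∫⁻ x in Ico (0 : ℝ) 1, ENNReal.ofReal (h x / (1 + x))
        ≤ ∫⁻ x in Ico (0 : ℝ) 1, ENNReal.ofReal (3 / 2) := by
          refine setLIntegral_mono' measurableSet_Ico fun x hx => ENNReal.ofReal_le_ofReal ?_
          have h3 := hb x (Ico_subset_Icc_self hx)
          rw [div_le_iff₀ (by linarith [hx.1])]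
          nlinarith [hx.1]
      _ = _ := by simp
  set A : Set ℝ := {x : ℝ | x ∈ Ico (0 : ℝ) 1 ∧ c ≤ t * logSum n x} with hA
  have hAm : MeasurableSet A :=
    measurableSet_Ico.inter (measurableSet_le measurable_const ((measurable_logSum n).const_mul t))
  have h3 : ENNReal.ofReal (Real.exp c / 4) * volume A ≤
      ∫⁻ x in Ico (0 : ℝ) 1, ENNReal.ofReal (Real.exp (t * logSum n x) * (h x / (1 + x))) := by
    rw [← setLIntegral_const]
    refine (setLIntegral_mono' hAm fun x hx => ENNReal.ofReal_le_ofReal ?_).trans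
      (lintegral_mono_set fun x hx => hx.1)
    have h4 := hb x (Ico_subset_Icc_self hx.1)
    have h5 : 1 / 4 ≤ h x / (1 + x) := by
      rw [le_div_iff₀ (by linarith [hx.1.1])]
      linarith [hx.1.2]
    rw [div_eq_mul_one_div]
    exact mul_le_mul (Real.exp_le_exp.2 hx.2) h5 (by norm_num) (Real.exp_pos _).le
  have h6 := (h3.trans h1).trans (mul_le_mul_right h2 _)
  rw [← ENNReal.ofReal_mul (by positivity)] at h6
  have hc : 0 < Real.exp c / 4 := by positivity
  calc volume A = ENNReal.ofReal (4 * Real.exp (-c)) *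
        (ENNReal.ofReal (Real.exp c / 4) * volume A) := by
        rw [← mul_assoc, ← ENNReal.ofReal_mul (by positivity)]
        have : 4 * Real.exp (-c) * (Real.exp c / 4) = 1 := by
          rw [Real.exp_neg]; field_simp
        rw [this, ENNReal.ofReal_one, one_mul]
    _ ≤ ENNReal.ofReal (4 * Real.exp (-c)) * ENNReal.ofReal (κ ^ n * (3 / 2)) :=
        mul_le_mul_right h6 _
    _ = _ := by
        rw [← ENNReal.ofReal_mul (by positivity)]
        congr 1
        ring

/-- Exponential large deviations for the Birkhoff sums of `-log` under the Gauss map. -/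
theorem exists_volume_logSum_deviation_le {δ : ℝ} (hδ : 0 < δ) :
    ∃ α : ℝ, 0 < α ∧ ∀ n : ℕ,
      volume {x : ℝ | x ∈ Ico (0 : ℝ) 1 ∧ n * δ ≤ |logSum n x - n * levyConst|} ≤
        ENNReal.ofReal (12 * Real.exp (-α * n)) := by
  obtain ⟨t₀, ht₀, H⟩ := exists_tilted_supersolution (half_pos hδ)
  refine ⟨t₀ * (δ / 2), by positivity, fun n => ?_⟩
  obtain ⟨h, hm, hb, hs⟩ := H t₀ (abs_of_pos ht₀).le
  obtain ⟨h', hm', hb', hs'⟩ := H (-t₀) (by rw [abs_neg, abs_of_pos ht₀])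
  have b1 := volume_le_mul_logSum_le (Real.exp_pos _).le hm hb hs n
    (t₀ * (n * (levyConst + δ)))
  have b2 := volume_le_mul_logSum_le (Real.exp_pos _).le hm' hb' hs' n
    (-t₀ * (n * (levyConst - δ)))
  have e1 : 6 * Real.exp (t₀ * levyConst + |t₀| * (δ / 2)) ^ n *
      Real.exp (-(t₀ * (n * (levyConst + δ)))) = 6 * Real.exp (-(t₀ * (δ / 2)) * n) := by
    rw [← Real.exp_nat_mul, mul_assoc, ← Real.exp_add, abs_of_pos ht₀]
    congr 2
    ring
  have e2 : 6 * Real.exp (-t₀ * levyConst + |-t₀| * (δ / 2)) ^ n *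
      Real.exp (-(-t₀ * (n * (levyConst - δ)))) = 6 * Real.exp (-(t₀ * (δ / 2)) * n) := by
    rw [← Real.exp_nat_mul, mul_assoc, ← Real.exp_add, abs_neg, abs_of_pos ht₀]
    congr 2
    ring
  rw [e1] at b1
  rw [e2] at b2
  have e3 : 12 * Real.exp (-(t₀ * (δ / 2)) * n) =
      6 * Real.exp (-(t₀ * (δ / 2)) * n) + 6 * Real.exp (-(t₀ * (δ / 2)) * n) := by ring
  rw [e3, ENNReal.ofReal_add (by positivity) (by positivity)]
  refine (measure_mono ?_).trans ((measure_union_le _ _).trans (add_le_add b1 b2))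
  rintro x ⟨hx, hd⟩
  rcases le_abs.1 hd with hd | hd
  · exact Or.inl ⟨hx, mul_le_mul_of_nonneg_left (by linarith) ht₀.le⟩
  · refine Or.inr ⟨hx, ?_⟩
    rw [neg_mul, neg_mul, neg_le_neg_iff]
    exact mul_le_mul_of_nonneg_left (by linarith) ht₀.le

/-! ### Denominators of convergents and Birkhoff sums -/

theorem Real.convergent_eq_floor_add_convergent_fract (y : ℝ) (n : ℕ) :
    y.convergent n = ⌊y⌋ + (Int.fract y).convergent n := by
  cases n with
  | zero => simp
  | succ n => simp [Real.convergent_succ]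

theorem convergent_succ_eq_inv_add {x : ℝ} (hx : x ∈ Ico (0 : ℝ) 1) (n : ℕ) :
    x.convergent (n + 1) = (⌊x⁻¹⌋ + (gaussMap x).convergent n)⁻¹ := by
  rw [Real.convergent_succ, Int.floor_eq_zero_iff.2 hx, Int.fract_eq_self.2 hx,
    Real.convergent_eq_floor_add_convergent_fract, gaussMap]
  simp

theorem one_le_floor_inv {x : ℝ} (hx : x ∈ Ioo (0 : ℝ) 1) : 1 ≤ ⌊x⁻¹⌋ :=
  Int.le_floor.2 (by simpa using ((one_le_inv₀ hx.1).2 hx.2.le))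

theorem gaussMap_mem_Ioo {x : ℝ} (hx : Irrational x) : gaussMap x ∈ Ioo (0 : ℝ) 1 :=
  ⟨lt_of_le_of_ne (Int.fract_nonneg _) fun h => by
    have h1 : Irrational (Int.fract x⁻¹) := hx.inv.sub_intCast _
    exact h1.ne_zero h.symm, Int.fract_lt_one _⟩

theorem irrational_gaussMap {x : ℝ} (hx : Irrational x) : Irrational (gaussMap x) :=
  hx.inv.sub_intCast _

theorem floor_inv_add_gaussMap (x : ℝ) : (⌊x⁻¹⌋ : ℝ) + gaussMap x = x⁻¹ := Int.floor_add_fract _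

theorem convergent_nonneg {x : ℝ} (hi : Irrational x) (hx : x ∈ Ioo (0 : ℝ) 1) (n : ℕ) :
    0 ≤ x.convergent n := by
  induction n generalizing x with
  | zero => simp [Int.floor_eq_zero_iff.2 (Ioo_subset_Ico_self hx)]
  | succ n ih =>
    rw [convergent_succ_eq_inv_add (Ioo_subset_Ico_self hx)]
    have h1 := ih (irrational_gaussMap hi) (gaussMap_mem_Ioo hi)
    have h2 : (1 : ℚ) ≤ ⌊x⁻¹⌋ := by exact_mod_cast one_le_floor_inv hx
    positivity

theorem convergent_succ_pos_le_one {x : ℝ} (hi : Irrational x) (hx : x ∈ Ioo (0 : ℝ) 1) (n : ℕ) :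
    0 < x.convergent (n + 1) ∧ x.convergent (n + 1) ≤ 1 := by
  rw [convergent_succ_eq_inv_add (Ioo_subset_Ico_self hx)]
  have h1 := convergent_nonneg (irrational_gaussMap hi) (gaussMap_mem_Ioo hi) n
  have h2 : (1 : ℚ) ≤ ⌊x⁻¹⌋ := by exact_mod_cast one_le_floor_inv hx
  exact ⟨by positivity, inv_le_one_of_one_le₀ (by linarith)⟩

/-- Adding an integer keeps the denominator, and inverting swaps it with the numerator. -/
theorem Rat.den_inv_intCast_add {a : ℤ} {r : ℚ} (h : 0 < a + r) :
    ((a + r)⁻¹.den : ℚ) = (a + r) * r.den := by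
  have h1 : (0 : ℤ) < (a + r).num := Rat.num_pos.2 h
  rw [Rat.den_inv_of_ne_zero h.ne', ← Rat.intCast_add_den a r, Rat.mul_den_eq_num]
  have : (((a + r).num.natAbs : ℤ) : ℚ) = ((a + r).num : ℚ) := by
    rw [Int.natAbs_of_nonneg h1.le]
  rwa [Int.cast_natCast] at this

theorem log_cfDenom_succ {x : ℝ} (hi : Irrational x) (hx : x ∈ Ioo (0 : ℝ) 1) (n : ℕ) :
    Real.log (cfDenom (n + 1) x) =
      Real.log (cfDenom n (gaussMap x)) - Real.log (x.convergent (n + 1)) := by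
  have hc := (convergent_succ_pos_le_one hi hx n).1
  unfold cfDenom
  rw [convergent_succ_eq_inv_add (Ioo_subset_Ico_self hx)] at hc ⊢
  have h1 := inv_pos.1 hc
  have h2 := congrArg (fun q : ℚ => (q : ℝ)) (Rat.den_inv_intCast_add h1)
  have h3 : (0 : ℝ) < (((⌊x⁻¹⌋ : ℚ) + (gaussMap x).convergent n : ℚ) : ℝ) := by exact_mod_cast h1
  simp only [Rat.cast_natCast, Rat.cast_mul] at h2
  rw [h2, Real.log_mul h3.ne' (by simp), Rat.cast_inv, Real.log_inv]
  ring

/-- For `a ≥ 1`, the map `r ↦ log (a + r)` has slope at most `1 / 2` in `log r`, on `(0, 1]`. -/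
theorem log_add_sub_log_add_le {a r y : ℝ} (ha : 1 ≤ a) (hy : 0 < y) (hyr : y ≤ r) (hr : r ≤ 1) :
    Real.log (a + r) - Real.log (a + y) ≤ 1 / 2 * (Real.log r - Real.log y) := by
  have hr0 := hy.trans_le hyr
  have h : Real.log ((a + r) ^ 2 * y) ≤ Real.log ((a + y) ^ 2 * r) := by
    refine Real.log_le_log (by positivity) ?_
    have : r * y ≤ a ^ 2 := by nlinarith
    nlinarith [mul_nonneg (sub_nonneg.2 hyr) (sub_nonneg.2 this)]
  rw [Real.log_mul (by positivity) hy.ne', Real.log_mul (by positivity) hr0.ne', Real.log_pow,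
    Real.log_pow] at h
  push_cast at h
  linarith

theorem abs_log_add_sub_log_add_le {a r y : ℝ} (ha : 1 ≤ a) (hr0 : 0 < r) (hr : r ≤ 1)
    (hy0 : 0 < y) (hy : y ≤ 1) :
    |Real.log (a + r) - Real.log (a + y)| ≤ 1 / 2 * |Real.log r - Real.log y| := by
  rcases le_total y r with h | h
  · rw [abs_of_nonneg (sub_nonneg.2 (Real.log_le_log (by positivity) (by linarith))),
      abs_of_nonneg (sub_nonneg.2 (Real.log_le_log hy0 h))]
    exact log_add_sub_log_add_le ha hy0 h hr
  · rw [abs_sub_comm, abs_sub_comm (Real.log r),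
      abs_of_nonneg (sub_nonneg.2 (Real.log_le_log (by positivity) (by linarith))),
      abs_of_nonneg (sub_nonneg.2 (Real.log_le_log hr0 h))]
    exact log_add_sub_log_add_le ha hr0 h hy

/-- The convergents approximate exponentially well in logarithmic scale. The bound `log 2` for the
first convergent holds because `T x ≤ 1 ≤ a_1(x)`. -/
theorem abs_log_convergent_sub_log_le {x : ℝ} (hi : Irrational x) (hx : x ∈ Ioo (0 : ℝ) 1)
    (n : ℕ) : |Real.log (x.convergent (n + 1)) - Real.log x| ≤ Real.log 2 * (1 / 2) ^ n := by
  induction n generalizing x with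
  | zero =>
    have hy := gaussMap_mem_Ioo hi
    have ha : (1 : ℝ) ≤ ⌊x⁻¹⌋ := by exact_mod_cast one_le_floor_inv hx
    have e : Real.log x = -Real.log (⌊x⁻¹⌋ + gaussMap x) := by
      rw [floor_inv_add_gaussMap, Real.log_inv, neg_neg]
    rw [convergent_succ_eq_inv_add (Ioo_subset_Ico_self hx), Real.convergent_zero,
      Int.floor_eq_zero_iff.2 (Ioo_subset_Ico_self hy), e]
    push_cast
    rw [Real.log_inv, add_zero, sub_neg_eq_add, neg_add_eq_sub,
      abs_of_nonneg (sub_nonneg.2 (Real.log_le_log (by positivity) (by linarith [hy.1]))),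
      sub_le_iff_le_add, pow_zero, mul_one, ← Real.log_mul (by norm_num) (by positivity)]
    exact Real.log_le_log (by linarith [hy.1]) (by linarith [hy.2])
  | succ n ih =>
    have hy := gaussMap_mem_Ioo hi
    have hyi := irrational_gaussMap hi
    have ha : (1 : ℝ) ≤ ⌊x⁻¹⌋ := by exact_mod_cast one_le_floor_inv hx
    have e : Real.log x = -Real.log (⌊x⁻¹⌋ + gaussMap x) := by
      rw [floor_inv_add_gaussMap, Real.log_inv, neg_neg]
    obtain ⟨h1, h2⟩ := convergent_succ_pos_le_one hyi hy n
    have h1' : (0 : ℝ) < (gaussMap x).convergent (n + 1) := by exact_mod_cast h1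
    have h2' : ((gaussMap x).convergent (n + 1) : ℝ) ≤ 1 := by exact_mod_cast h2
    rw [convergent_succ_eq_inv_add (Ioo_subset_Ico_self hx), e]
    push_cast
    rw [Real.log_inv, neg_sub_neg, abs_sub_comm]
    refine (abs_log_add_sub_log_add_le ha h1' h2' hy.1 hy.2.le).trans ?_
    have := ih hyi hy
    rw [pow_succ]
    linarith

/-- The Birkhoff sum of `-log` approximates `log q_n` up to a bounded error: the errors of the
convergents of `T^k x` are summable. -/
theorem abs_log_cfDenom_sub_logSum_le {x : ℝ} (hi : Irrational x) (hx : x ∈ Ioo (0 : ℝ) 1)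
    (n : ℕ) :
    |Real.log (cfDenom n x) - logSum n x| ≤ 2 * Real.log 2 * (1 - (1 / 2) ^ n) := by
  induction n generalizing x with
  | zero => simp [logSum_zero, cfDenom]
  | succ n ih =>
    have h1 := ih (irrational_gaussMap hi) (gaussMap_mem_Ioo hi)
    have h2 := abs_log_convergent_sub_log_le hi hx n
    rw [log_cfDenom_succ hi hx, logSum_succ]
    have e : Real.log (cfDenom n (gaussMap x)) - Real.log (x.convergent (n + 1)) -
        (-Real.log x + logSum n (gaussMap x)) =
        (Real.log (cfDenom n (gaussMap x)) - logSum n (gaussMap x)) -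
          (Real.log (x.convergent (n + 1)) - Real.log x) := by ring
    rw [e]
    refine (abs_sub _ _).trans ((add_le_add h1 h2).trans (le_of_eq ?_))
    rw [pow_succ]
    ring

/-! ### Large deviations of the denominators -/

theorem mainTheorem3 (δ : ℝ) (hδ : 0 < δ) :
    ∃ N : ℕ, 0 < N ∧ ∃ B : ℝ, 0 < B ∧ ∃ α : ℝ, 0 < α ∧ ∀ n : ℕ, N ≤ n →
      MeasureTheory.volume
          {x : ℝ | x ∈ Set.Ico (0 : ℝ) 1 ∧
            δ ≤ |(1 / (n : ℝ)) * Real.log (cfDenom n x : ℝ)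
                  - Real.pi ^ 2 / (12 * Real.log 2)|}
        ≤ ENNReal.ofReal (B * Real.exp (-α * (n : ℝ))) := by
  obtain ⟨α, hα, H⟩ := exists_volume_logSum_deviation_le (half_pos hδ)
  have hl : 0 < Real.log 2 := Real.log_pos (by norm_num)
  -- For these `n` the error `2 * log 2` of the Birkhoff sum is at most `n * δ / 2`.
  refine ⟨⌈4 * Real.log 2 / δ⌉₊, Nat.ceil_pos.2 (by positivity), 12, by norm_num, α, hα,
    fun n hn => ?_⟩
  have hn1 : 4 * Real.log 2 / δ ≤ n := Nat.ceil_le.1 hn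
  have hn0 : (0 : ℝ) < n := lt_of_lt_of_le (by positivity) hn1
  rw [div_le_iff₀ hδ] at hn1
  have hQ : volume (range ((↑) : ℚ → ℝ)) = 0 := (countable_range _).measure_zero _
  refine (measure_mono (t := {x : ℝ | x ∈ Ico (0 : ℝ) 1 ∧
    n * (δ / 2) ≤ |logSum n x - n * levyConst|} ∪ range ((↑) : ℚ → ℝ)) ?_).trans
    ((measure_union_le _ _).trans (by rw [hQ, add_zero]; exact H n))
  rintro x ⟨hx, hd⟩
  by_cases hi : Irrational x
  · refine Or.inl ⟨hx, ?_⟩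
    have h1 := abs_log_cfDenom_sub_logSum_le hi
      ⟨lt_of_le_of_ne hx.1 hi.ne_zero.symm, hx.2⟩ n
    have h2 : 2 * Real.log 2 * (1 - (1 / 2) ^ n) ≤ 2 * Real.log 2 := by
      have : 0 ≤ 2 * Real.log 2 * (1 / 2) ^ n := by positivity
      linarith
    have e : 1 / (n : ℝ) * Real.log (cfDenom n x) - Real.pi ^ 2 / (12 * Real.log 2) =
        (Real.log (cfDenom n x) - n * levyConst) / n := by
      rw [levyConst, sub_div, mul_div_cancel_left₀ _ hn0.ne']; ring
    rw [e, abs_div, abs_of_pos hn0, le_div_iff₀ hn0] at hd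
    have h3 := abs_sub_le (Real.log (cfDenom n x)) (logSum n x) (n * levyConst)
    linarith
  · exact Or.inr (not_not.1 hi)
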